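/- **Conventions.** $\{0,1\}^*$ is the set of finite binary words, $|w|$ the length of $w$, and $x_{1:n}=x_1\dots x_n$ for $x\in\{0,1\}^{\mathbb N}$. For words $p,w$ put $\langle p,w\rangle=1^{|p|}0\,p\,w$. A partial function $\varphi:\{0,1\}^*\times\{0,1\}^{\mathbb N}\rightharpoonup\{0,1\}^*$ is *computable* if a single algorithm that may query the bits of the infinite sequence $o$ computes $\varphi(w,o)$ from $w$ for all $w,o$ (and does not halt where $\varphi(w,o)$ is undefined). A computable partial function $U$ is *universal* if for every computable $\varphi$ there is a word $p$ with $\varphi(w,o)=U(\langle p,w\rangle,o)$ for all $w,o$ (both sides may be undefined). For a universal $U$, the complexity of $w$ relative to $o$ is $K[w\mid o]=\min\{|q| : U(q,o)=w\}$. For $s\in[0,1]$ the *greedy binary expansion* $y$ of $s$ is given by $r_0=s$, $y_{n}=0$ if $r_{n-1}<\tfrac12$ and $y_n=1$ otherwise, $r_n=2r_{n-1}-y_n$. For $\beta\in(1,2)$ let $K[w\mid\beta]=K[w\mid o_\beta]$, where $o_\beta$ is the greedy binary expansion of $\beta-1$, and let $n(\beta)=\lceil n\log_\beta 2\rceil$.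 Let $\Omega_\beta$ be the set of $x\in\{0,1\}^{\mathbb N}$ with $\sum_{i\ge1}x_i\beta^{-i}\le1$. For a word $w$, let $M_\beta(w)$ be the lexicographically largest (with $0<1$) of the words $v$ with $|v|=|w|$ and $\sum_{i=1}^{|w|}v_i\beta^{-i}=\sum_{i=1}^{|w|}w_i\beta^{-i}$. For $x\in\{0,1\}^{\mathbb N}$, $M_\beta x$ is given by the words $(M_\beta x)_{1:m}:=M_\beta(x_{1:m})$, $m\in\mathbb N$ (which need not be prefixes of one another). As $(M_\beta x)_{1:m}$ and $x_{1:m}$ have the same value in base $\beta$, $M_\beta x$ represents the same number $s=\sum_{i\ge1}x_i\beta^{-i}$ as $x$. With $y$ the greedy binary expansion of $s$, put $$\underline\Delta_\beta(M_\beta x)=\liminf_{n\to\infty}\frac{K[(M_\beta x)_{1:n(\beta)}\mid\beta]-K[y_{1:n}\mid\beta]}{n},\qquad \bar\Delta_\beta(M_\beta x)=\limsup_{n\to\infty}\frac{K[(M_\beta x)_{1:n(\beta)}\mid\beta]-K[y_{1:n}\mid\beta]}{n}.$$ A *Pisot number* is an algebraic integer all of whose Galois conjugates, other than itself, have modulus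 strictly less than $1$. **Statement.** Let $U$ be any universal computable function and let $K$ be the complexity with respect to $U$. If $\beta\in(1,2)$ is a Pisot number, then $$\underline\Delta_\beta(M_\beta x)=\bar\Delta_\beta(M_\beta x)=0\qquad\text{for all } x\in\Omega_\beta .$$ -/

import Mathlib

noncomputable section

namespace BetaComplexity

open Filter

/-! ### Effective algorithms equipped with an infinite binary sequence -/

/-- The partial recursive functionals `F : {0,1}^ℕ × ℕ ⇀ ℕ`: the least class containing zero,
successor, the two projections of the pairing function and the functional that reads one bit
of the infinite sequence, and closed under pairing, composition, primitive recursion and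
minimisation.  These are `Nat.Partrec` (and `Nat.RecursiveIn`), uniformly in the oracle. -/
inductive OraclePartrec : ((ℕ → Bool) → ℕ →. ℕ) → Prop
  | zero : OraclePartrec fun _ _ => Part.some 0
  | succ : OraclePartrec fun _ n => Part.some (n + 1)
  | left : OraclePartrec fun _ n => Part.some n.unpair.1
  | right : OraclePartrec fun _ n => Part.some n.unpair.2
  | oracle : OraclePartrec fun o n => Part.some (o n).toNat
  | pair {F G : (ℕ → Bool) → ℕ →. ℕ} (hF : OraclePartrec F) (hG : OraclePartrec G) :
      OraclePartrec fun o n => Nat.pair <$> F o n <*> G o n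
  | comp {F G : (ℕ → Bool) → ℕ →. ℕ} (hF : OraclePartrec F) (hG : OraclePartrec G) :
      OraclePartrec fun o n => G o n >>= F o
  | prec {F G : (ℕ → Bool) → ℕ →. ℕ} (hF : OraclePartrec F) (hG : OraclePartrec G) :
      OraclePartrec fun o => Nat.unpaired fun a n =>
        n.rec (F o a) fun y IH => IH >>= fun i => G o (Nat.pair a (Nat.pair y i))
  | rfind {F : (ℕ → Bool) → ℕ →. ℕ} (hF : OraclePartrec F) :
      OraclePartrec fun o a =>
        Nat.rfind fun n => (fun m => decide (m = 0)) <$> F o (Nat.pair a n)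

/-- A partial function `φ : {0,1}^* × {0,1}^ℕ ⇀ {0,1}^*` is computable if some effective algorithm
equipped with the sequence `o`, presented with the word `x`, delivers `φ x o` (and does not halt
where `φ x o` is undefined).  Words are coded by natural numbers in the usual way. -/
def OracleComputable (φ : List Bool → (ℕ → Bool) → Part (List Bool)) : Prop :=
  OraclePartrec fun o n =>
    Part.bind (Encodable.decode (α := List Bool) n : Option (List Bool)) fun x =>
      (φ x o).map Encodable.encode

/-- `⟨p, x⟩ = 1^{|p|} 0 p x`. -/
def pairWords (p x : List Bool) : List Bool :=
  List.replicate p.length true ++ false :: (p ++ x)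

/-- `U` is a universal computable function: it is computable, and every computable `φ` has a
program `p` with `φ(x, o) = U(⟨p, x⟩, o)` for all `x` and `o` (both sides may be undefined). -/
def IsUniversal (U : List Bool → (ℕ → Bool) → Part (List Bool)) : Prop :=
  OracleComputable U ∧
    ∀ φ : List Bool → (ℕ → Bool) → Part (List Bool), OracleComputable φ →
      ∃ p : List Bool, ∀ (x : List Bool) (o : ℕ → Bool), φ x o = U (pairWords p x) o

/-- `K_U[x | o]`: the length of a shortest word `q` with `U(q, o) = x`. -/
def complexity (U : List Bool → (ℕ → Bool) → Part (List Bool)) (x : List Bool) (o : ℕ → Bool) :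
    ℕ :=
  sInf {k | ∃ q : List Bool, q.length = k ∧ x ∈ U q o}

/-! ### Expansions.  Position `i` of a sequence or word (counted from `0`) is its digit `i + 1`. -/

/-- The word `x_1 … x_n`. -/
def pre (x : ℕ → Bool) (n : ℕ) : List Bool :=
  (List.range n).map x

/-- `∑_{i ≥ 1} x_i β^{-i}`. -/
def seqValue (β : ℝ) (x : ℕ → Bool) : ℝ :=
  ∑' i : ℕ, ((x i).toNat : ℝ) * (β ^ (i + 1))⁻¹

/-- `∑_{i = 1}^{|w|} w_i β^{-i}`. -/
def wordValue (β : ℝ) (w : List Bool) : ℝ :=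
  ∑ i : Fin w.length, ((w.get i).toNat : ℝ) * (β ^ (i.val + 1))⁻¹

/-- The set `Ω_β` of sequences that are `β`-expansions of a number in `[0, 1]`. -/
def Omega (β : ℝ) : Set (ℕ → Bool) :=
  {x | seqValue β x ≤ 1}

/-- The remainder before step `n` of the greedy binary algorithm on input `s`:
`r ← s`, then repeatedly `b ← 0` if `r < 1/2`, `b ← 1` otherwise, and `r ← 2 r - b`. -/
def greedyRem (s : ℝ) : ℕ → ℝ
  | 0 => s
  | n + 1 => 2 * greedyRem s n - if greedyRem s n < 1 / 2 then 0 else 1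

/-- The greedy binary expansion of `s ∈ [0, 1]`. -/
def greedyBinary (s : ℝ) (n : ℕ) : Bool :=
  if greedyRem s n < 1 / 2 then false else true

/-- `K[x | β]`, the complexity of `x` relative to the greedy binary expansion of `β - 1`. -/
def complexityRel (U : List Bool → (ℕ → Bool) → Part (List Bool)) (x : List Bool) (β : ℝ) : ℕ :=
  complexity U x (greedyBinary (β - 1))

/-- `n(β) = ⌈n log_β 2⌉`. -/
def scaledLength (β : ℝ) (n : ℕ) : ℕ :=
  ⌈(n : ℝ) * Real.logb β 2⌉₊

/-! ### Lexicographically maximal representatives -/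

/-- The class `[w]_β` of the words that have the length and the value of `w`. -/
def wordClass (β : ℝ) (w : List Bool) : Set (List Bool) :=
  {v | v.length = w.length ∧ wordValue β v = wordValue β w}

theorem exists_isGreatest_wordClass (β : ℝ) (w : List Bool) :
    ∃ v, IsGreatest (wordClass β w) v := by
  have hfin : (wordClass β w).Finite :=
    (List.finite_length_eq Bool w.length).subset fun v hv => hv.1
  have hne : (wordClass β w).Nonempty := ⟨w, rfl, rfl⟩
  obtain ⟨v, hv, hmax⟩ := Set.exists_max_image (wordClass β w) id hfin hne
  exact ⟨v, hv, fun u hu => hmax u hu⟩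

/-- `M_β(w)`: the lexicographically largest word of `[w]_β` (with `0 < 1`). -/
def lexMaxRep (β : ℝ) (w : List Bool) : List Bool :=
  (exists_isGreatest_wordClass β w).choose

theorem lexMaxRep_isGreatest (β : ℝ) (w : List Bool) :
    IsGreatest (wordClass β w) (lexMaxRep β w) :=
  (exists_isGreatest_wordClass β w).choose_spec

/-- `M_β x`, given by its prefixes `(M_β x)_{1:m} := M_β(x_{1:m})`. -/
def lexMaxPre (β : ℝ) (x : ℕ → Bool) (m : ℕ) : List Bool :=
  lexMaxRep β (pre x m)

/-- `(M_β x)_{1:m}` represents the same number as `x_{1:m}`, so that `M_β x` represents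
the same number `∑ x_i β^{-i}` as `x`. -/
theorem wordValue_lexMaxPre (β : ℝ) (x : ℕ → Bool) (m : ℕ) :
    wordValue β (lexMaxPre β x m) = wordValue β (pre x m) :=
  (lexMaxRep_isGreatest β (pre x m)).1.2

/-! ### Comparison with the binary expansion -/

/-- `(K[w_{1:n(β)} | β] - K[y_{1:n} | β]) / n`, where `w m` is the prefix of length `m` of a
`β`-expansion of `s` and `y` is the greedy binary expansion of `s`. -/
def gap (U : List Bool → (ℕ → Bool) → Part (List Bool)) (β s : ℝ) (w : ℕ → List Bool) (n : ℕ) :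
    ℝ :=
  ((complexityRel U (w (scaledLength β n)) β : ℝ) -
    (complexityRel U (pre (greedyBinary s) n) β : ℝ)) / n

/-- The lower relative complexity (limit inferior in the extended reals) for the expansion of `s`
with prefixes `w`. -/
def lowerDelta (U : List Bool → (ℕ → Bool) → Part (List Bool)) (β s : ℝ) (w : ℕ → List Bool) :
    EReal :=
  liminf (fun n : ℕ => ((gap U β s w n : ℝ) : EReal)) atTop

/-- The upper relative complexity (limit superior in the extended reals) for the expansion of `s`
with prefixes `w`. -/
def upperDelta (U : List Bool → (ℕ → Bool) → Part (List Bool)) (β s : ℝ) (w : ℕ → List Bool) :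
    EReal :=
  limsup (fun n : ℕ => ((gap U β s w n : ℝ) : EReal)) atTop

/-- A Pisot number: an algebraic integer whose Galois conjugates (the complex roots of its minimal
polynomial other than itself) all lie strictly inside the unit disk. -/
def IsPisot (β : ℝ) : Prop :=
  IsIntegral ℤ β ∧ ∀ z : ℂ, Polynomial.aeval z (minpoly ℚ β) = 0 → z ≠ (β : ℂ) → ‖z‖ < 1

end BetaComplexity

end

noncomputable section

namespace BetaComplexity

open Filter

/-! The two complexities differ by a bounded amount, so the quotient by `n` tends to `0`. Put `m =
n(β)`, `w = M_β(x_{1:m})` and `u = y_{1:n}`. Since `β ^ m` lies between `2 ^ n` and `2 * 2 ^ n`, the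
words `u` and `w` determine the same number `s` up to errors of order `2 ^ (-n)`. Each word thus
confines the other to a short list, and a program that names a position in that list recovers it at
constant cost (`exists_complexity_le_add_of_mem_list`).

From `w` to `u`, the list is bounded because binary values scaled by `2 ^ n` are integers. From `u`
to `w`, it is bounded for two reasons. In a Pisot base the distinct values of words of one length,
scaled by `β ^ m`, are at least some fixed `δ > 0` apart (`IsPisot.exists_separation`), so only
boundedly many values are possible; and the lexicographically largest representative leaves one word
for each value.

The lists must be computable from the digits of `β - 1`, although equality of values in base `β` is
not decidable from approximations in general. Here separation helps again: a comparison in a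
rational base `b / K` with tolerance `1 / N`, where `N * δ > 2`, decides equality exactly
(`IsApprox.close_of_eq`, `IsApprox.eq_of_close`). Hence largest representatives are recognised by
the integer test `IsTop`, and the size of the error by the integer test `Near`. The other word's
length is not given to the program, so `Near` also compares scales, which leaves boundedly many
lengths. -/

/-! ### Oracle functionals -/

/-- The oracle class contains every partial recursive function. -/
theorem OraclePartrec.of_partrec {f : ℕ →. ℕ} (hf : Nat.Partrec f) :
    OraclePartrec fun _ => f := by
  induction hf with
  | zero => exact OraclePartrec.zero
  | succ => exact OraclePartrec.succ
  | left => exact OraclePartrec.left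
  | right => exact OraclePartrec.right
  | pair _ _ hf hg => exact OraclePartrec.pair hf hg
  | comp _ _ hf hg => exact OraclePartrec.comp hf hg
  | prec _ _ hf hg => exact OraclePartrec.prec hf hg
  | rfind _ hf => exact OraclePartrec.rfind hf

theorem OraclePartrec.of_eq {F G : (ℕ → Bool) → ℕ →. ℕ} (hF : OraclePartrec F)
    (h : ∀ o n, F o n = G o n) : OraclePartrec G := by
  have : F = G := funext fun o => funext fun n => h o n
  exact this ▸ hF

theorem OraclePartrec.of_primrec {f : ℕ → ℕ} (hf : Primrec f) :
    OraclePartrec fun _ n => Part.some (f n) :=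
  OraclePartrec.of_partrec (Partrec.nat_iff.1 hf.to_comp)

/-- The integer `⌊2 ^ k (1 + t)⌋` read off the first `k` binary digits `o` of `t`. -/
def oracleFloor (o : ℕ → Bool) : ℕ → ℕ
  | 0 => 1
  | k + 1 => 2 * oracleFloor o k + (o k).toNat

theorem oraclePartrec_oracleFloor :
    OraclePartrec fun o k => Part.some (oracleFloor o k) := by
  have hs : Primrec fun p : ℕ => 2 * p.unpair.2.unpair.2 :=
    Primrec.nat_mul.comp (Primrec.const 2)
      (Primrec.snd.comp (Primrec.unpair.comp (Primrec.snd.comp Primrec.unpair)))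
  have hi : Primrec fun p : ℕ => p.unpair.2.unpair.1 :=
    Primrec.fst.comp (Primrec.unpair.comp (Primrec.snd.comp Primrec.unpair))
  have ha : Primrec fun p : ℕ => p.unpair.1 + p.unpair.2 :=
    Primrec.nat_add.comp (Primrec.fst.comp Primrec.unpair) (Primrec.snd.comp Primrec.unpair)
  have h0 : Primrec fun k : ℕ => Nat.pair 0 k :=
    Primrec₂.natPair.comp (Primrec.const 0) Primrec.id
  have hG := (OraclePartrec.of_primrec ha).comp
    ((OraclePartrec.of_primrec hs).pair (OraclePartrec.oracle.comp (OraclePartrec.of_primrec hi)))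
  have key := (OraclePartrec.prec (OraclePartrec.of_primrec (Primrec.const 1)) hG).comp
    (OraclePartrec.of_primrec h0)
  refine key.of_eq fun o k => ?_
  simp only [Part.bind_eq_bind, Part.bind_some, Nat.unpaired, Nat.unpair_pair]
  induction k with
  | zero => rfl
  | succ k ih =>
    rw [oracleFloor]
    simp only
    rw [ih]
    simp [Seq.seq]

theorem OracleComputable.comp {φ ψ : List Bool → (ℕ → Bool) → Part (List Bool)}
    (hφ : OracleComputable φ) (hψ : OracleComputable ψ) :
    OracleComputable fun x o => (ψ x o).bind fun y => φ y o := by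
  refine (OraclePartrec.comp hφ hψ).of_eq fun o n => ?_
  simp [Part.bind_assoc, Part.bind_map, Part.map_bind]

/-- A primitive recursive function of a word `x` and of the first `κ x` digits of the oracle. -/
theorem oracleComputable_of_primrec {F : List Bool → ℕ → Option (List Bool)}
    (hF : Primrec₂ F) {κ : List Bool → ℕ} (hκ : Primrec κ) :
    OracleComputable fun x o => (F x (oracleFloor o (κ x)) : Part (List Bool)) := by
  -- The default `0` is used only where `n` codes no word, and there the result is undefined anyway.
  have hk : Primrec fun n : ℕ => ((Encodable.decode (α := List Bool) n).map κ).getD 0 :=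
    Primrec.option_getD.comp (Primrec.option_map Primrec.decode (hκ.comp Primrec.snd).to₂)
      (Primrec.const 0)
  have hf : Primrec fun p : ℕ =>
      (Encodable.decode (α := List Bool) p.unpair.1).bind fun x =>
        (F x p.unpair.2).map Encodable.encode :=
    Primrec.option_bind (Primrec.decode.comp (Primrec.fst.comp Primrec.unpair))
      (Primrec.option_map
        (hF.comp Primrec.snd (Primrec.snd.comp (Primrec.unpair.comp Primrec.fst)))
        (Primrec.encode.comp Primrec.snd).to₂).to₂
  have hp : OraclePartrec fun _ p =>
      (((Encodable.decode (α := List Bool) p.unpair.1).bind fun x =>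
        (F x p.unpair.2).map Encodable.encode : Option ℕ) : Part ℕ) :=
    OraclePartrec.of_partrec (Partrec.nat_iff.1 (Computable.ofOption hf.to_comp))
  have key := hp.comp ((OraclePartrec.of_primrec Primrec.id).pair
    (oraclePartrec_oracleFloor.comp (OraclePartrec.of_primrec hk)))
  refine key.of_eq fun o n => ?_
  simp only [Part.bind_eq_bind, Part.bind_some, Seq.seq, Part.map_eq_map, Part.map_some, id,
    Nat.unpair_pair]
  cases h : (Encodable.decode (α := List Bool) n) with
  | none => simp
  | some x =>
    simp only [Option.map_some, Option.getD_some, Option.bind_some]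
    simp only [Part.coe_some, Part.bind_some]
    generalize F x (oracleFloor o (κ x)) = y
    cases y <;> simp

/-! ### Complexity with respect to a universal function -/

/-- The identity is computable, so every word has a program and the infimum in `complexity` is
attained rather than being the junk value of `sInf ∅`. -/
theorem exists_program {U : List Bool → (ℕ → Bool) → Part (List Bool)} (hU : IsUniversal U)
    (x : List Bool) (o : ℕ → Bool) : ∃ q, q.length = complexity U x o ∧ x ∈ U q o := by
  have hid : OracleComputable fun y _ => Part.some y := by
    have := oracleComputable_of_primrec (F := fun y _ => some y)
      (Primrec.option_some.comp Primrec.fst).to₂ (Primrec.const 0)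
    simpa using this
  obtain ⟨p, hp⟩ := hU.2 _ hid
  refine Nat.sInf_mem (s := {k | ∃ q : List Bool, q.length = k ∧ x ∈ U q o})
    ⟨_, pairWords p x, rfl, ?_⟩
  rw [← hp]
  exact Part.mem_some x

theorem complexity_le {U : List Bool → (ℕ → Bool) → Part (List Bool)} {x q : List Bool}
    {o : ℕ → Bool} (h : x ∈ U q o) : complexity U x o ≤ q.length :=
  Nat.sInf_le ⟨q, rfl, h⟩

/-- A computable transformation raises the complexity by at most a constant. -/
theorem exists_complexity_le_add {U : List Bool → (ℕ → Bool) → Part (List Bool)}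
    (hU : IsUniversal U) {φ : List Bool → (ℕ → Bool) → Part (List Bool)}
    (hφ : OracleComputable φ) :
    ∃ c, ∀ u v o, v ∈ φ u o → complexity U v o ≤ complexity U u o + c := by
  obtain ⟨p, hp⟩ := hU.2 _ (hφ.comp hU.1)
  -- This is the overhead of the pairing: `⟨p, q⟩` has length `2 |p| + 1 + |q|`.
  refine ⟨2 * p.length + 1, fun u v o hv => ?_⟩
  obtain ⟨q, hq, hu⟩ := exists_program hU u o
  have hmem : v ∈ U (pairWords p q) o := by
    rw [← hp]
    exact Part.mem_bind hu hv
  have := complexity_le hmem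
  simp only [pairWords, List.length_append, List.length_replicate, List.length_cons] at this
  omega

/-- If `v` occurs at a bounded place in a list that is computed from `u` and from finitely many
digits of the oracle, then the complexity of `v` exceeds that of `u` by at most a constant. -/
theorem exists_complexity_le_add_of_mem_list {U : List Bool → (ℕ → Bool) → Part (List Bool)}
    (hU : IsUniversal U) {F : List Bool → ℕ → List (List Bool)} (hF : Primrec₂ F)
    {κ : List Bool → ℕ} (hκ : Primrec κ) (B : ℕ) :
    ∃ c, ∀ u v o, v ∈ F u (oracleFloor o (κ u)) → (F u (oracleFloor o (κ u))).length ≤ B →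
      complexity U v o ≤ complexity U u o + c := by
  -- For a fixed position `i`, taking the entry at `i` is one computable transformation. Only the
  -- positions below `B` occur, and the sum of their constants serves for all of them.
  have h : ∀ i : ℕ, ∃ c, ∀ u v o, (F u (oracleFloor o (κ u)))[i]? = some v →
      complexity U v o ≤ complexity U u o + c := by
    intro i
    have hi : Primrec₂ fun u b => (F u b)[i]? :=
      (Primrec.list_getElem?.comp hF (Primrec.const i)).to₂
    obtain ⟨c, hc⟩ := exists_complexity_le_add hU (oracleComputable_of_primrec hi hκ)
    exact ⟨c, fun u v o hv => hc u v o (by simp [hv])⟩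
  choose c hc using h
  refine ⟨∑ i ∈ Finset.range B, c i, fun u v o hv hB => ?_⟩
  obtain ⟨i, hi, rfl⟩ := List.getElem_of_mem hv
  have h1 := hc i u _ o (List.getElem?_eq_getElem hi)
  have h2 : c i ≤ ∑ i ∈ Finset.range B, c i :=
    Finset.single_le_sum (fun _ _ => Nat.zero_le _) (Finset.mem_range.2 (hi.trans_le hB))
  omega

/-! ### Lists of words, and comparison of values by integer arithmetic -/

/-- The words of length `m` in lexicographically decreasing order. -/
def words : ℕ → List (List Bool)
  | 0 => [[]]
  | m + 1 => (words m).map (List.cons true) ++ (words m).map (List.cons false)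

theorem mem_words {m : ℕ} {w : List Bool} : w ∈ words m ↔ w.length = m := by
  induction m generalizing w with
  | zero => simp [words]
  | succ m ih =>
    rcases w with _ | ⟨d, w⟩
    · simp [words]
    · cases d <;> simp [words, ih]

theorem pairwise_words (m : ℕ) : (words m).Pairwise (· > ·) := by
  induction m with
  | zero => simp [words]
  | succ m ih =>
    rw [words, List.pairwise_append, List.pairwise_map, List.pairwise_map]
    refine ⟨ih.imp fun h => ?_, ih.imp fun h => ?_, ?_⟩
    · exact List.cons_lt_cons_iff.2 (Or.inr ⟨rfl, h⟩)
    · exact List.cons_lt_cons_iff.2 (Or.inr ⟨rfl, h⟩)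
    · simp only [List.mem_map]
      rintro _ ⟨v, -, rfl⟩ _ ⟨w, -, rfl⟩
      exact List.cons_lt_cons_iff.2 (Or.inl (by decide))

/-- The words of length at most `M`. -/
def wordsUpTo (M : ℕ) : List (List Bool) :=
  (List.range (M + 1)).flatMap words

theorem mem_wordsUpTo {M : ℕ} {w : List Bool} : w ∈ wordsUpTo M ↔ w.length ≤ M := by
  simp [wordsUpTo, mem_words]

theorem nodup_wordsUpTo (M : ℕ) : (wordsUpTo M).Nodup := by
  rw [wordsUpTo, List.nodup_flatMap]
  refine ⟨fun m _ => (pairwise_words m).imp fun h => ne_of_gt h, ?_⟩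
  refine List.nodup_range.imp fun {m n} h v hm hn => h ?_
  rw [← mem_words.1 hm, ← mem_words.1 hn]

/-- The pair of `K ^ |w| ∑ w_i (b / K) ^ (|w| - i)` and `K ^ |w|`. -/
def horner (b K : ℕ) (w : List Bool) : ℕ × ℕ :=
  w.foldl (fun p d => (p.1 * b + d.toNat * (p.2 * K), p.2 * K)) (0, 1)

/-- The values of `v` and `w` in the base `b / K`, scaled by `(b / K) ^ |w|`, differ by at most
`1 / N`. -/
def Close (N b K : ℕ) (v w : List Bool) : Prop :=
  N * (horner b K v).1 ≤ N * (horner b K w).1 + (horner b K w).2 ∧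
    N * (horner b K w).1 ≤ N * (horner b K v).1 + (horner b K w).2

open scoped Classical in
/-- `w` is the first, hence the largest, of the words of its length whose value is close to its
own. -/
def IsTop (N b K : ℕ) (w : List Bool) : Prop :=
  ((words w.length).filter fun v => Close N b K v w).head? = some w

/-- The scales `2 ^ |u|` and `(b / K) ^ |w|` are comparable, and the binary value of `u` is close
to the value of `w` in the base `b / K`. -/
def Near (D b K : ℕ) (u w : List Bool) : Prop :=
  (2 ^ u.length * (horner b K w).2 ≤ 2 * b ^ w.length ∧
    b ^ w.length ≤ 2 * (2 ^ u.length * (horner b K w).2)) ∧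
  b ^ w.length * (horner 2 1 u).1 ≤
    (horner b K w).1 * 2 ^ u.length + D * ((horner b K w).2 * 2 ^ u.length) ∧
  (horner b K w).1 * 2 ^ u.length ≤
    b ^ w.length * (horner 2 1 u).1 + D * ((horner b K w).2 * 2 ^ u.length)

/-! ### Primitive recursiveness of the integer tests and of the candidate lists. -/

section Primrec

theorem primrec₂_pow : Primrec₂ ((· ^ ·) : ℕ → ℕ → ℕ) :=
  Primrec₂.unpaired'.1 Nat.Primrec.pow

theorem primrec_words : Primrec words := by
  have hc : ∀ d : Bool, Primrec₂ fun (_ : ℕ) (p : ℕ × List (List Bool)) =>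
      p.2.map (List.cons d) := fun d =>
    (Primrec.list_map (Primrec.snd.comp Primrec.snd)
      (Primrec.list_cons.comp (Primrec.const d) Primrec.snd).to₂).to₂
  refine (Primrec.nat_rec' (h := fun (_ : ℕ) p => p.2.map (List.cons true) ++
    p.2.map (List.cons false)) Primrec.id (Primrec.const [[]])
    (Primrec.list_append.comp (hc true) (hc false)).to₂).of_eq fun m => ?_
  induction m with
  | zero => rfl
  | succ m ih => simp only [id] at ih ⊢; rw [words, ih]

theorem primrec_wordsUpTo : Primrec wordsUpTo :=
  Primrec.list_flatMap (Primrec.list_range.comp Primrec.succ) (primrec_words.comp Primrec.snd).to₂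

variable {α : Type*} [Primcodable α]

theorem primrec_horner {b K : α → ℕ} {w : α → List Bool} (hb : Primrec b) (hK : Primrec K)
    (hw : Primrec w) : Primrec fun a => horner (b a) (K a) (w a) := by
  have hd : Primrec (fun p : α × (ℕ × ℕ) × Bool => p.2.2.toNat) :=
    (Primrec.dom_finite Bool.toNat).comp (Primrec.snd.comp Primrec.snd)
  have hS : Primrec (fun p : α × (ℕ × ℕ) × Bool => p.2.1.2 * K p.1) :=
    Primrec.nat_mul.comp (Primrec.snd.comp (Primrec.fst.comp Primrec.snd))
      (hK.comp Primrec.fst)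
  exact Primrec.list_foldl hw (Primrec.const (0, 1))
    (Primrec.pair (Primrec.nat_add.comp
      (Primrec.nat_mul.comp (Primrec.fst.comp (Primrec.fst.comp Primrec.snd))
        (hb.comp Primrec.fst)) (Primrec.nat_mul.comp hd hS)) hS).to₂

theorem primrecPred_close (N : ℕ) {b K : α → ℕ} {v w : α → List Bool} (hb : Primrec b)
    (hK : Primrec K) (hv : Primrec v) (hw : Primrec w) :
    PrimrecPred fun a => Close N (b a) (K a) (v a) (w a) := by
  have h1 := primrec_horner hb hK hv
  have h2 := primrec_horner hb hK hw
  have hN : Primrec fun _ : α => N := Primrec.const N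
  have m1 := Primrec.nat_mul.comp hN (Primrec.fst.comp h1)
  have m2 := Primrec.nat_mul.comp hN (Primrec.fst.comp h2)
  exact (Primrec.nat_le.comp m1 (Primrec.nat_add.comp m2 (Primrec.snd.comp h2))).and
    (Primrec.nat_le.comp m2 (Primrec.nat_add.comp m1 (Primrec.snd.comp h2)))

theorem primrecPred_isTop (N : ℕ) {b K : α → ℕ} {w : α → List Bool} (hb : Primrec b)
    (hK : Primrec K) (hw : Primrec w) : PrimrecPred fun a => IsTop N (b a) (K a) (w a) := by
  classical
  have hR : PrimrecRel fun v a => Close N (b a) (K a) v (w a) :=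
    primrecPred_close N (hb.comp Primrec.snd) (hK.comp Primrec.snd) Primrec.fst
      (hw.comp Primrec.snd)
  have hF := hR.listFilter.comp (primrec_words.comp (Primrec.list_length.comp hw)) Primrec.id
  refine (Primrec.eq.comp (Primrec.list_head?.comp hF) (Primrec.option_some.comp hw)).of_eq
    fun a => ?_
  rw [IsTop]
  exact Eq.congr (by congr) rfl

theorem primrecPred_near (D : ℕ) {b K : α → ℕ} {u w : α → List Bool} (hb : Primrec b)
    (hK : Primrec K) (hu : Primrec u) (hw : Primrec w) :
    PrimrecPred fun a => Near D (b a) (K a) (u a) (w a) := by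
  have h := primrec_horner hb hK hw
  have hA := Primrec.fst.comp h
  have hS := Primrec.snd.comp h
  have hU := Primrec.fst.comp (primrec_horner (Primrec.const 2) (Primrec.const 1) hu)
  have hn := primrec₂_pow.comp (Primrec.const 2) (Primrec.list_length.comp hu)
  have hm := primrec₂_pow.comp hb (Primrec.list_length.comp hw)
  have hD := Primrec.nat_mul.comp (Primrec.const D) (Primrec.nat_mul.comp hS hn)
  have h2 : Primrec fun _ : α => 2 := Primrec.const 2
  have hl := Primrec.nat_mul.comp hn hS
  have hx := Primrec.nat_mul.comp hm hU
  have hy := Primrec.nat_mul.comp hA hn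
  exact ((Primrec.nat_le.comp hl (Primrec.nat_mul.comp h2 hm)).and
    (Primrec.nat_le.comp hm (Primrec.nat_mul.comp h2 hl))).and
    ((Primrec.nat_le.comp hx (Primrec.nat_add.comp hy hD)).and
      (Primrec.nat_le.comp hy (Primrec.nat_add.comp hx hD)))

end Primrec

open scoped Classical in
/-- The words `u` that are near `w`, where `b` is the floor of `2 ^ (2 |w| + c) β`. -/
def nearLeft (D c : ℕ) (w : List Bool) (b : ℕ) : List (List Bool) :=
  (wordsUpTo w.length).filter fun u => Near D b (2 ^ (2 * w.length + c)) u w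

open scoped Classical in
/-- The top words `w` that are near `u`, where `b` is the floor of `2 ^ (2 (L |u| + 1) + c) β`. -/
def nearRight (D c L N : ℕ) (u : List Bool) (b : ℕ) : List (List Bool) :=
  (wordsUpTo (L * u.length + 1)).filter fun w =>
    Near D b (2 ^ (2 * (L * u.length + 1) + c)) u w ∧
      IsTop N b (2 ^ (2 * (L * u.length + 1) + c)) w

theorem primrec_nearLeft (D c : ℕ) : Primrec₂ (nearLeft D c) := by
  classical
  have hl : Primrec fun p : List Bool × (List Bool × ℕ) => p.2.1.length :=
    Primrec.list_length.comp (Primrec.fst.comp Primrec.snd)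
  have hR : PrimrecRel fun (u : List Bool) (p : List Bool × ℕ) =>
      Near D p.2 (2 ^ (2 * p.1.length + c)) u p.1 :=
    primrecPred_near D (Primrec.snd.comp Primrec.snd)
      (primrec₂_pow.comp (Primrec.const 2)
        (Primrec.nat_add.comp (Primrec.nat_mul.comp (Primrec.const 2) hl) (Primrec.const c)))
      Primrec.fst (Primrec.fst.comp Primrec.snd)
  refine (hR.listFilter.comp
    (primrec_wordsUpTo.comp (Primrec.list_length.comp Primrec.fst)) Primrec.id).of_eq fun p => ?_
  rw [nearLeft]
  congr

theorem primrec_nearRight (D c L N : ℕ) : Primrec₂ (nearRight D c L N) := by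
  classical
  have hm : Primrec fun u : List Bool => L * u.length + 1 :=
    Primrec.succ.comp (Primrec.nat_mul.comp (Primrec.const L) Primrec.list_length)
  have hk : Primrec fun u : List Bool => 2 ^ (2 * (L * u.length + 1) + c) :=
    primrec₂_pow.comp (Primrec.const 2)
      (Primrec.nat_add.comp (Primrec.nat_mul.comp (Primrec.const 2) hm) (Primrec.const c))
  have hK : Primrec fun p : List Bool × (List Bool × ℕ) =>
      2 ^ (2 * (L * p.2.1.length + 1) + c) := hk.comp (Primrec.fst.comp Primrec.snd)
  have hR : PrimrecRel fun (w : List Bool) (p : List Bool × ℕ) =>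
      Near D p.2 (2 ^ (2 * (L * p.1.length + 1) + c)) p.1 w ∧
        IsTop N p.2 (2 ^ (2 * (L * p.1.length + 1) + c)) w :=
    (primrecPred_near D (Primrec.snd.comp Primrec.snd) hK (Primrec.fst.comp Primrec.snd)
      Primrec.fst).and (primrecPred_isTop N (Primrec.snd.comp Primrec.snd) hK Primrec.fst)
  refine (hR.listFilter.comp
    (primrec_wordsUpTo.comp (hm.comp Primrec.fst)) Primrec.id).of_eq fun p => ?_
  rw [nearRight]
  congr

/-! ### Values of words as polynomials in the base -/

/-- `∑ w_i t ^ (|w| - i)`. -/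
def evalWord {R : Type*} [CommRing R] (t : R) (w : List Bool) : R :=
  w.foldl (fun a d => a * t + (d.toNat : R)) 0

section evalWord

variable {R : Type*} [CommRing R]

@[simp] theorem evalWord_nil (t : R) : evalWord t [] = 0 := rfl

@[simp] theorem evalWord_concat (t : R) (w : List Bool) (d : Bool) :
    evalWord t (w ++ [d]) = evalWord t w * t + (d.toNat : R) := by
  simp [evalWord]

/-- Serves the conjugates of a value, through the embeddings of `ℚ(β)`, and the passage from `ℤ` to
`ℝ` in base `2`. -/
theorem map_evalWord {S F : Type*} [CommRing S] [FunLike F R S] [RingHomClass F R S] (f : F)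
    (t : R) (w : List Bool) : f (evalWord t w) = evalWord (f t) w := by
  induction w using List.reverseRecOn with
  | nil => simp
  | append_singleton w d ih => simp [ih]

theorem isIntegral_evalWord {t : R} (ht : IsIntegral ℤ t) (w : List Bool) :
    IsIntegral ℤ (evalWord t w) := by
  induction w using List.reverseRecOn with
  | nil => simpa using isIntegral_zero
  | append_singleton w d ih =>
    rw [evalWord_concat]
    exact (ih.mul ht).add (by simpa using isIntegral_algebraMap (R := ℤ) (x := (d.toNat : ℤ)))

end evalWord

theorem pre_succ (x : ℕ → Bool) (n : ℕ) : pre x (n + 1) = pre x n ++ [x n] := by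
  simp [pre, List.range_succ]

@[simp] theorem length_pre (x : ℕ → Bool) (n : ℕ) : (pre x n).length = n := by
  simp [pre]

theorem wordValue_concat (β : ℝ) (w : List Bool) (d : Bool) :
    wordValue β (w ++ [d]) = wordValue β w + d.toNat * (β ^ (w.length + 1))⁻¹ := by
  -- Reading digits by `getD` removes the dependent index; the default is never reached, as `i <
  -- v.length`.
  have h : ∀ v : List Bool, wordValue β v =
      ∑ i ∈ Finset.range v.length, ((v.getD i false).toNat : ℝ) * (β ^ (i + 1))⁻¹ := by
    intro v
    rw [← Fin.sum_univ_eq_sum_range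
      (fun i => ((v.getD i false).toNat : ℝ) * (β ^ (i + 1))⁻¹), wordValue]
    simp
  rw [h, h, List.length_append, List.length_singleton, Finset.sum_range_succ]
  congr 1
  · refine Finset.sum_congr rfl fun i hi => ?_
    rw [List.getD_append _ _ _ _ (Finset.mem_range.1 hi)]
  · simp

/-- The scaling by `β ^ w.length` makes the value an algebraic integer when `β` is one. At a fixed
length, equality of `wordValue` and of `evalWord` amount to the same. -/
theorem evalWord_eq {β : ℝ} (hβ : β ≠ 0) (w : List Bool) :
    evalWord β w = β ^ w.length * wordValue β w := by
  induction w using List.reverseRecOn with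
  | nil => simp [wordValue]
  | append_singleton w d ih =>
    rw [evalWord_concat, wordValue_concat, ih, List.length_append, List.length_singleton]
    field_simp
    ring

/-- The summand `1` absorbs the new digit in the induction; at `t = 2` the word of ones attains the
bound. -/
theorem evalWord_mem_Icc {t : ℝ} (h0 : 0 ≤ t) (h2 : t ≤ 2) (w : List Bool) :
    0 ≤ evalWord t w ∧ evalWord t w + 1 ≤ 2 ^ w.length := by
  induction w using List.reverseRecOn with
  | nil => simp
  | append_singleton w d ih =>
    have hd : (d.toNat : ℝ) ≤ 1 := by exact_mod_cast Bool.toNat_le d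
    rw [evalWord_concat, List.length_append, List.length_singleton, pow_succ]
    refine ⟨by have := mul_nonneg ih.1 h0; positivity, ?_⟩
    nlinarith [mul_le_mul_of_nonneg_left h2 ih.1]

/-- Appending a digit multiplies the error by `β ≤ 2` and adds at most `2 ^ |w| * ε`. The resulting
factor `4 ^ |w|` is crude, but it only affects how many oracle digits are read. -/
theorem evalWord_sub_mem_Icc {β t ε : ℝ} (h0 : 0 ≤ t) (ht : t ≤ β) (hβ : β ≤ 2)
    (hε : β - t ≤ ε) (w : List Bool) :
    0 ≤ evalWord β w - evalWord t w ∧ evalWord β w - evalWord t w ≤ 4 ^ w.length * ε := by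
  induction w using List.reverseRecOn with
  | nil => simp; linarith
  | append_singleton w d ih =>
    rw [evalWord_concat, evalWord_concat, List.length_append, List.length_singleton, pow_succ]
    obtain ⟨h1, h3⟩ := evalWord_mem_Icc h0 (ht.trans hβ) w
    have e : evalWord β w * β + (d.toNat : ℝ) - (evalWord t w * t + (d.toNat : ℝ)) =
      (evalWord β w - evalWord t w) * β + evalWord t w * (β - t) := by ring
    have hp : (2 : ℝ) ^ w.length ≤ 4 ^ w.length := pow_le_pow_left₀ (by norm_num) (by norm_num) _
    have hs : (0 : ℝ) ≤ β - t := by linarith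
    rw [e]
    refine ⟨add_nonneg (mul_nonneg ih.1 (h0.trans ht)) (mul_nonneg h1 hs), ?_⟩
    have a1 := mul_le_mul_of_nonneg_left hβ ih.1
    have a2 : evalWord t w * (β - t) ≤ 4 ^ w.length * ε :=
      mul_le_mul (by linarith) hε hs (by positivity)
    have a3 := mul_nonneg (show (0 : ℝ) ≤ 4 ^ w.length by positivity) (hs.trans hε)
    linarith [ih.2]

theorem pow_sub_mem_Icc {β t ε : ℝ} (h0 : 0 ≤ t) (ht : t ≤ β) (hβ : β ≤ 2)
    (hε : β - t ≤ ε) (m : ℕ) :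
    0 ≤ β ^ m - t ^ m ∧ β ^ m - t ^ m ≤ 4 ^ m * ε := by
  induction m with
  | zero => simp; linarith
  | succ m ih =>
    have h3 : t ^ m ≤ 2 ^ m := pow_le_pow_left₀ h0 (ht.trans hβ) m
    have h1 : 0 ≤ t ^ m := by positivity
    have e : β ^ (m + 1) - t ^ (m + 1) = (β ^ m - t ^ m) * β + t ^ m * (β - t) := by ring
    have hp : (2 : ℝ) ^ m ≤ 4 ^ m := pow_le_pow_left₀ (by norm_num) (by norm_num) _
    have hs : (0 : ℝ) ≤ β - t := by linarith
    rw [e, pow_succ]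
    refine ⟨add_nonneg (mul_nonneg ih.1 (h0.trans ht)) (mul_nonneg h1 hs), ?_⟩
    have a1 := mul_le_mul_of_nonneg_left hβ ih.1
    have a2 : t ^ m * (β - t) ≤ 4 ^ m * ε := mul_le_mul (by linarith) hε hs (by positivity)
    have a3 := mul_nonneg (show (0 : ℝ) ≤ 4 ^ m by positivity) (hs.trans hε)
    linarith [ih.2]

theorem horner_snd (b K : ℕ) (w : List Bool) : (horner b K w).2 = K ^ w.length := by
  induction w using List.reverseRecOn with
  | nil => rfl
  | append_singleton w d ih =>
    rw [List.length_append, List.length_singleton, pow_succ, ← ih]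
    simp [horner]

theorem horner_fst (b : ℕ) {K : ℕ} (hK : 0 < K) (w : List Bool) :
    ((horner b K w).1 : ℝ) = K ^ w.length * evalWord ((b : ℝ) / K) w := by
  induction w using List.reverseRecOn with
  | nil => simp [horner]
  | append_singleton w d ih =>
    have h : (horner b K (w ++ [d])).1 =
        (horner b K w).1 * b + d.toNat * ((horner b K w).2 * K) := by simp [horner]
    rw [h, horner_snd, evalWord_concat, List.length_append, List.length_singleton]
    push_cast
    rw [ih]
    have : (K : ℝ) ≠ 0 := by positivity
    field_simp
    ring

/-- Distinct words of the same length have binary values at distance at least `1`. -/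
theorem one_le_abs_evalWord_two_sub {u v : List Bool} (hl : u.length = v.length) (huv : u ≠ v) :
    1 ≤ |evalWord (2 : ℝ) u - evalWord 2 v| := by
  -- The parity of an integer value is the last digit, so words of one length can be read back from
  -- their values.
  have hinj : evalWord (2 : ℤ) u ≠ evalWord 2 v := by
    induction u using List.reverseRecOn generalizing v with
    | nil => exact absurd (List.eq_nil_of_length_eq_zero hl.symm).symm huv
    | append_singleton u d ih =>
      rcases List.eq_nil_or_concat v with rfl | ⟨v, e, rfl⟩
      · simp at hl
      · simp only [List.length_append, List.length_singleton] at hl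
        rw [List.concat_eq_append] at *
        rw [evalWord_concat, evalWord_concat]
        intro h
        have := @ih v (by simpa using hl)
        rcases eq_or_ne u v with rfl | hne
        · cases d <;> cases e <;> simp_all
        · have := this hne
          cases d <;> cases e <;> simp at h <;> omega
  have h := Int.one_le_abs (sub_ne_zero.2 hinj)
  have e : ∀ w : List Bool, ((evalWord (2 : ℤ) w : ℤ) : ℝ) = evalWord 2 w := fun w => by
    simpa using map_evalWord (Int.castRingHom ℝ) 2 w
  rw [← e, ← e]
  exact_mod_cast h

/-! ### Greedy binary expansions -/

theorem greedyRem_mem_Icc {s : ℝ} (h0 : 0 ≤ s) (h1 : s ≤ 1) (n : ℕ) :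
    0 ≤ greedyRem s n ∧ greedyRem s n ≤ 1 := by
  induction n with
  | zero => exact ⟨h0, h1⟩
  | succ n ih =>
    rw [greedyRem]
    split_ifs <;> constructor <;> linarith

theorem greedyRem_succ (s : ℝ) (n : ℕ) :
    greedyRem s (n + 1) = 2 * greedyRem s n - (greedyBinary s n).toNat := by
  rw [greedyRem, greedyBinary]
  split_ifs <;> simp

theorem evalWord_pre_greedyBinary (s : ℝ) (n : ℕ) :
    s * 2 ^ n = evalWord 2 (pre (greedyBinary s) n) + greedyRem s n := by
  induction n with
  | zero => simp [pre, greedyRem]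
  | succ n ih =>
    rw [pre_succ, evalWord_concat, greedyRem_succ]
    linear_combination 2 * ih

theorem oracleFloor_greedyBinary (t : ℝ) (k : ℕ) :
    (1 + t) * 2 ^ k = oracleFloor (greedyBinary t) k + greedyRem t k := by
  induction k with
  | zero => simp [oracleFloor, greedyRem]
  | succ k ih =>
    rw [oracleFloor, greedyRem_succ]
    push_cast
    linear_combination 2 * ih

/-! ### Expansions in base `β` -/

theorem seqValue_nonneg {β : ℝ} (hβ : 1 < β) (x : ℕ → Bool) : 0 ≤ seqValue β x :=
  tsum_nonneg fun i => by positivity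

/-- The difference is the value of the shifted sequence `x_{m+1} x_{m+2} …`, which is at most the
geometric sum of `β ^ (-i)` over `i ≥ 1`. -/
theorem seqValue_sub_mem_Icc {β : ℝ} (hβ : 1 < β) (x : ℕ → Bool) (m : ℕ) :
    0 ≤ seqValue β x * β ^ m - evalWord β (pre x m) ∧
      seqValue β x * β ^ m - evalWord β (pre x m) ≤ (β - 1)⁻¹ := by
  have hβ0 : 0 < β := by linarith
  have hg : HasSum (fun i : ℕ => (β ^ (i + 1))⁻¹) (β - 1)⁻¹ := by
    have h := (hasSum_geometric_of_lt_one (inv_nonneg.2 hβ0.le) (inv_lt_one_of_one_lt₀ hβ)).mul_left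
      β⁻¹
    have e1 : (fun i : ℕ => (β ^ (i + 1))⁻¹) = fun i => β⁻¹ * β⁻¹ ^ i := by
      ext i
      rw [pow_succ, mul_inv, inv_pow, mul_comm]
    have e2 : (β - 1)⁻¹ = β⁻¹ * (1 - β⁻¹)⁻¹ := by
      rw [← mul_inv, mul_sub, mul_one, mul_inv_cancel₀ hβ0.ne']
    rwa [e1, e2]
  have hle : ∀ (z : ℕ → Bool) (i : ℕ), ((z i).toNat : ℝ) * (β ^ (i + 1))⁻¹ ≤ (β ^ (i + 1))⁻¹ := by
    intro z i
    have : ((z i).toNat : ℝ) ≤ 1 := by exact_mod_cast Bool.toNat_le _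
    exact mul_le_of_le_one_left (by positivity) this
  have hs : ∀ z : ℕ → Bool, Summable fun i => ((z i).toNat : ℝ) * (β ^ (i + 1))⁻¹ := fun z =>
    Summable.of_nonneg_of_le (fun i => by positivity) (hle z) hg.summable
  have key : seqValue β x * β ^ m - evalWord β (pre x m) = seqValue β fun i => x (m + i) := by
    induction m with
    | zero => simp [pre]
    | succ m ih =>
      have h := (hs fun i => x (m + i)).sum_add_tsum_nat_add 1
      simp only [Finset.sum_range_one] at h
      have e : (∑' i : ℕ, ((x (m + (i + 1))).toNat : ℝ) * (β ^ (i + 1 + 1))⁻¹) * β =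
          seqValue β fun i => x (m + 1 + i) := by
        rw [seqValue, ← tsum_mul_right]
        refine tsum_congr fun i => ?_
        rw [show m + (i + 1) = m + 1 + i by ring]
        field_simp
        ring
      rw [← e, pre_succ, evalWord_concat]
      have e2 : seqValue β (fun i => x (m + i)) * β = (x m).toNat +
          (∑' i : ℕ, ((x (m + (i + 1))).toNat : ℝ) * (β ^ (i + 1 + 1))⁻¹) * β := by
        rw [seqValue, ← h]
        simp
        field_simp
      rw [← ih] at e2
      linear_combination e2
  rw [key]
  exact ⟨seqValue_nonneg hβ _, 
    ((hs _).tsum_le_tsum (hle _) hg.summable).trans_eq hg.tsum_eq⟩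

/-- Rounding the exponent up costs at most one factor `β < 2`. The two bounds on the length tell how
far to search for candidates. -/
theorem scaledLength_bounds {β : ℝ} (hβ : β ∈ Set.Ioo (1 : ℝ) 2) (n : ℕ) :
    2 ^ n ≤ β ^ scaledLength β n ∧ β ^ scaledLength β n ≤ 2 * 2 ^ n ∧ n ≤ scaledLength β n ∧
      scaledLength β n ≤ ⌈Real.logb β 2⌉₊ * n + 1 := by
  have hβ0 : 0 < β := by linarith [hβ.1]
  have hα : 0 < Real.logb β 2 := Real.logb_pos hβ.1 (by norm_num)
  have hp : β ^ (n * Real.logb β 2 : ℝ) = 2 ^ n := by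
    rw [mul_comm, Real.rpow_mul hβ0.le, Real.rpow_logb hβ0 hβ.1.ne' (by norm_num),
      Real.rpow_natCast]
  have h1 : (n * Real.logb β 2 : ℝ) ≤ scaledLength β n := Nat.le_ceil _
  have h2 : (scaledLength β n : ℝ) < n * Real.logb β 2 + 1 := Nat.ceil_lt_add_one (by positivity)
  have a : 2 ^ n ≤ β ^ scaledLength β n := by
    rw [← hp, ← Real.rpow_natCast β]
    exact Real.rpow_le_rpow_of_exponent_le hβ.1.le h1
  refine ⟨a, ?_, ?_, ?_⟩
  · rw [← Real.rpow_natCast β]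
    calc β ^ (scaledLength β n : ℝ) ≤ β ^ (n * Real.logb β 2 + 1 : ℝ) :=
          Real.rpow_le_rpow_of_exponent_le hβ.1.le h2.le
      _ = 2 ^ n * β := by rw [Real.rpow_add hβ0, hp, Real.rpow_one]
      _ ≤ 2 * 2 ^ n := by nlinarith [hβ.2, show (0 : ℝ) < 2 ^ n by positivity]
  · have : (2 : ℝ) ^ n ≤ 2 ^ scaledLength β n :=
      a.trans (pow_le_pow_left₀ hβ0.le hβ.2.le _)
    exact (pow_le_pow_iff_right₀ (by norm_num : (1 : ℝ) < 2)).1 this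
  · have h3 := Nat.le_ceil (Real.logb β 2)
    have : (scaledLength β n : ℝ) ≤ (⌈Real.logb β 2⌉₊ * n + 1 : ℕ) := by
      push_cast
      nlinarith [Nat.cast_nonneg (α := ℝ) n]
    exact_mod_cast this

/-! ### Separation of values in a Pisot base -/

/-- The digits of the difference have modulus at most `1`, so a geometric series in `‖z‖` bounds it;
`(1 - ‖z‖)⁻¹` is the fixed point of `r ↦ r * ‖z‖ + 1`. -/
theorem norm_evalWord_sub_le {z : ℂ} (hz : ‖z‖ < 1) {v w : List Bool}
    (h : v.length = w.length) :
    ‖evalWord z v - evalWord z w‖ ≤ (1 - ‖z‖)⁻¹ := by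
  induction v using List.reverseRecOn generalizing w with
  | nil =>
    obtain rfl : w = [] := List.eq_nil_of_length_eq_zero h.symm
    simpa using hz.le
  | append_singleton v d ih =>
    rcases List.eq_nil_or_concat w with rfl | ⟨w, e, rfl⟩
    · simp at h
    · rw [List.concat_eq_append] at *
      rw [evalWord_concat, evalWord_concat]
      have h1 := ih (w := w) (by simpa using h)
      have h0 : 0 < 1 - ‖z‖ := by linarith
      have hde : ‖((d.toNat : ℂ) - e.toNat)‖ ≤ 1 := by cases d <;> cases e <;> simp
      calc ‖evalWord z v * z + (d.toNat : ℂ) - (evalWord z w * z + e.toNat)‖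
          = ‖(evalWord z v - evalWord z w) * z + ((d.toNat : ℂ) - e.toNat)‖ := by ring_nf
        _ ≤ ‖evalWord z v - evalWord z w‖ * ‖z‖ + 1 :=
            (norm_add_le _ _).trans (by rw [norm_mul]; gcongr)
        _ ≤ (1 - ‖z‖)⁻¹ * ‖z‖ + 1 := by gcongr
        _ = (1 - ‖z‖)⁻¹ := by field_simp; ring

/-- Garsia's lemma: the distinct values of the words of one length in a Pisot base are uniformly
separated. -/
theorem IsPisot.exists_separation {β : ℝ} (hP : IsPisot β) :
    ∃ δ > 0, ∀ v w : List Bool, v.length = w.length → evalWord β v ≠ evalWord β w →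
      δ ≤ |evalWord β v - evalWord β w| := by
  classical
  have hβ : IsIntegral ℚ β := hP.1.tower_top
  let K := IntermediateField.adjoin ℚ {β}
  have : FiniteDimensional ℚ K := IntermediateField.adjoin.finiteDimensional hβ
  let g : K := IntermediateField.AdjoinSimple.gen ℚ β
  have hg : algebraMap K ℝ g = β := IntermediateField.AdjoinSimple.algebraMap_gen ℚ β
  have hgi : IsIntegral ℤ g := by
    refine (isIntegral_algHom_iff ((algebraMap K ℝ).toIntAlgHom)
      (algebraMap K ℝ).injective).1 ?_
    simpa [hg] using hP.1
  let σ₀ : K →ₐ[ℚ] ℂ := (Complex.ofRealAm.restrictScalars ℚ).comp K.val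
  have hσ₀ : ∀ z : K, ‖σ₀ z‖ = |algebraMap K ℝ z| := fun z => Complex.norm_real _
  -- An embedding is determined by the image of `g`, so every one but the inclusion `σ₀` sends `g`
  -- to a conjugate other than `β`.
  have hlt : ∀ σ : K →ₐ[ℚ] ℂ, σ ≠ σ₀ → ‖σ g‖ < 1 := by
    intro σ hσ
    refine hP.2 _ ?_ fun h => hσ ?_
    · rw [← IntermediateField.minpoly_gen ℚ β, Polynomial.aeval_algHom_apply]
      exact (congrArg σ (minpoly.aeval ℚ g)).trans (map_zero σ)
    · refine IntermediateField.adjoin_algHom_ext ℚ fun x hx => ?_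
      obtain rfl := Set.mem_singleton_iff.1 hx
      exact h
  set M : ℝ := ∏ σ ∈ Finset.univ.erase σ₀, (1 - ‖σ g‖)⁻¹ with hM
  have hM0 : 0 < M := Finset.prod_pos fun σ hσ =>
    inv_pos.2 (sub_pos.2 (hlt σ (Finset.ne_of_mem_erase hσ)))
  refine ⟨M⁻¹, inv_pos.2 hM0, fun v w hl hvw => ?_⟩
  set z : K := evalWord g v - evalWord g w with hz
  have hzβ : algebraMap K ℝ z = evalWord β v - evalWord β w := by
    rw [hz, map_sub, map_evalWord, map_evalWord, hg]
  have hz0 : z ≠ 0 := by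
    intro h
    rw [h, map_zero] at hzβ
    exact hvw (sub_eq_zero.1 hzβ.symm)
  have hzi : IsIntegral ℤ z := (isIntegral_evalWord hgi v).sub (isIntegral_evalWord hgi w)
  -- The norm of the nonzero algebraic integer `z` is a nonzero rational integer, so the conjugates
  -- of `z` have product of modulus at least `1`. The factor at `σ₀` is the difference in question,
  -- and the other factors contribute at most `M`.
  obtain ⟨a, ha⟩ := IsIntegrallyClosed.isIntegral_iff.1 (Algebra.isIntegral_norm ℚ hzi)
  have hprod := Algebra.norm_eq_prod_embeddings ℚ ℂ z
  have ha0 : a ≠ 0 := by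
    rintro rfl
    rw [map_zero] at ha
    exact hz0 (Algebra.norm_eq_zero_iff.1 ha.symm)
  have h1 : 1 ≤ ∏ σ : K →ₐ[ℚ] ℂ, ‖σ z‖ := by
    rw [← norm_prod, ← hprod, ← ha]
    have : (1 : ℝ) ≤ |(a : ℝ)| := by exact_mod_cast Int.one_le_abs ha0
    simpa using this
  rw [← Finset.mul_prod_erase _ _ (Finset.mem_univ σ₀), hσ₀, hzβ] at h1
  have h2 : ∏ σ ∈ Finset.univ.erase σ₀, ‖σ z‖ ≤ M := by
    refine Finset.prod_le_prod (fun _ _ => norm_nonneg _) fun σ hσ => ?_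
    rw [hz, map_sub, map_evalWord, map_evalWord]
    exact norm_evalWord_sub_le (hlt σ (Finset.ne_of_mem_erase hσ)) hl
  rw [inv_le_iff_one_le_mul₀ hM0]
  exact h1.trans (mul_le_mul_of_nonneg_left h2 (abs_nonneg _))

/-- A list without duplicates is short if a size `ℓ` and a value `g` of its entries are confined
to bounded ranges, and the values of distinct entries of the same size are separated. -/
theorem length_le_of_separated {α : Type*} {l : List α} (hl : l.Nodup) {ℓ : α → ℕ} {g : α → ℝ}
    {t : ℕ → ℝ} {c B : ℕ} {r δ : ℝ} (hδ : 0 < δ)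
    (hℓ : ∀ a ∈ l, c ≤ ℓ a + B ∧ ℓ a ≤ c + B) (hg : ∀ a ∈ l, |g a - t (ℓ a)| ≤ r)
    (hsep : ∀ a ∈ l, ∀ a' ∈ l, a ≠ a' → ℓ a = ℓ a' → δ ≤ |g a - g a'|) :
    l.length ≤ (2 * B + 1) * (⌊2 * r / δ⌋₊ + 1) := by
  classical
  rw [← List.toFinset_card_of_nodup hl]
  -- Pigeonhole: each entry is sent to its size, shifted to start at `0` (no truncation, by `hℓ`),
  -- and to the cell of width `δ` that contains its value. Two entries of one size in one cell
  -- differ by less than `δ`.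
  have h := Finset.card_le_card_of_injOn (s := l.toFinset)
    (t := Finset.range (2 * B + 1) ×ˢ Finset.range (⌊2 * r / δ⌋₊ + 1))
    (fun a => (ℓ a + B - c, ⌊(g a - t (ℓ a) + r) / δ⌋₊)) ?_ ?_
  · simpa using h
  · intro a ha
    have ha := List.mem_toFinset.1 ha
    have h1 := hℓ a ha
    have h2 := abs_le.1 (hg a ha)
    simp only [Finset.coe_product, Set.mem_prod, Finset.mem_coe, Finset.mem_range]
    refine ⟨by omega, Nat.lt_succ_of_le (Nat.floor_le_floor ?_)⟩
    gcongr
    linarith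
  · intro a ha a' ha' h
    have ha := List.mem_toFinset.1 ha
    have ha' := List.mem_toFinset.1 ha'
    simp only [Prod.mk.injEq] at h
    have e : ℓ a = ℓ a' := by have := hℓ a ha; have := hℓ a' ha'; omega
    by_contra hne
    have hs := hsep a ha a' ha' hne e
    have p : ∀ b ∈ l, 0 ≤ (g b - t (ℓ b) + r) / δ := fun b hb =>
      div_nonneg (by linarith [(abs_le.1 (hg b hb)).1]) hδ.le
    have f1 := Nat.floor_le (p a ha)
    have f2 := Nat.lt_floor_add_one ((g a - t (ℓ a) + r) / δ)
    have f3 := Nat.floor_le (p a' ha')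
    have f4 := Nat.lt_floor_add_one ((g a' - t (ℓ a') + r) / δ)
    rw [h.2] at f1 f2
    have e2 : (g a - g a') / δ =
        (g a - t (ℓ a) + r) / δ - (g a' - t (ℓ a') + r) / δ := by rw [e]; ring
    have : |(g a - g a') / δ| < 1 := by rw [e2, abs_lt]; constructor <;> linarith
    rw [abs_div, abs_of_pos hδ, div_lt_one hδ] at this
    linarith

/-! ### The integer tests in terms of real values -/

theorem close_iff (N b : ℕ) {K : ℕ} (hK : 0 < K) {v w : List Bool} (h : v.length = w.length) :
    Close N b K v w ↔
      N * |evalWord ((b : ℝ) / K) v - evalWord ((b : ℝ) / K) w| ≤ 1 := by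
  have hS : (0 : ℝ) < K ^ w.length := by positivity
  have e : N * |evalWord ((b : ℝ) / K) v - evalWord ((b : ℝ) / K) w| =
      |N * evalWord ((b : ℝ) / K) v - N * evalWord ((b : ℝ) / K) w| := by
    rw [← mul_sub, abs_mul, Nat.abs_cast]
  rw [e, abs_le, Close, ← Nat.cast_le (α := ℝ), ← Nat.cast_le (α := ℝ)]
  push_cast
  rw [horner_fst b hK, horner_fst b hK, horner_snd, h]
  push_cast
  constructor
  · rintro ⟨h1, h2⟩
    constructor <;> refine le_of_mul_le_mul_left ?_ hS <;> linarith
  · rintro ⟨h1, h2⟩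
    have a1 := mul_le_mul_of_nonneg_left h1 hS.le
    have a2 := mul_le_mul_of_nonneg_left h2 hS.le
    constructor <;> linarith

/-- After division by both scales, the last condition says that the numbers given by `u` and `w`
differ by at most `D * (b / K) ^ (-|w|)`. -/
theorem near_iff (D b : ℕ) {K : ℕ} (hK : 0 < K) (u w : List Bool) :
    Near D b K u w ↔
      ((2 : ℝ) ^ u.length ≤ 2 * ((b : ℝ) / K) ^ w.length ∧
        ((b : ℝ) / K) ^ w.length ≤ 2 * 2 ^ u.length) ∧
      |((b : ℝ) / K) ^ w.length * evalWord 2 u - evalWord ((b : ℝ) / K) w * 2 ^ u.length| ≤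
        D * 2 ^ u.length := by
  have hS : (0 : ℝ) < K ^ w.length := by positivity
  have hb : (b : ℝ) ^ w.length = K ^ w.length * ((b : ℝ) / K) ^ w.length := by
    rw [← mul_pow]
    congr 1
    field_simp
  have hU : ((horner 2 1 u).1 : ℝ) = evalWord 2 u := by simpa using horner_fst 2 one_pos u
  rw [Near]
  iterate 4 rw [← Nat.cast_le (α := ℝ)]
  push_cast
  rw [hU, horner_fst b hK, horner_snd, hb, abs_le]
  push_cast
  constructor
  · rintro ⟨⟨h1, h2⟩, h3, h4⟩
    refine ⟨⟨?_, ?_⟩, ?_, ?_⟩ <;> refine le_of_mul_le_mul_left ?_ hS <;> linarith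
  · rintro ⟨⟨h1, h2⟩, h3, h4⟩
    have a1 := mul_le_mul_of_nonneg_left h1 hS.le
    have a2 := mul_le_mul_of_nonneg_left h2 hS.le
    have a3 := mul_le_mul_of_nonneg_left h3 hS.le
    have a4 := mul_le_mul_of_nonneg_left h4 hS.le
    refine ⟨⟨?_, ?_⟩, ?_, ?_⟩ <;> linarith

/-- `b / K` approximates `β` from below so well that values of words of length at most `M` change
by at most `1 / (2 N)`. -/
structure IsApprox (β : ℝ) (b K N M : ℕ) : Prop where
  pos : 0 < K
  le : (b : ℝ) / K ≤ β
  sub_le : β - (b : ℝ) / K ≤ 1 / K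
  large : 4 ^ M * (2 * N) ≤ K

theorem isApprox_oracleFloor {β : ℝ} (hβ : β ∈ Set.Ioo (1 : ℝ) 2) (M N : ℕ) :
    IsApprox β (oracleFloor (greedyBinary (β - 1)) (2 * M + 2 * N)) (2 ^ (2 * M + 2 * N)) N M := by
  have h := oracleFloor_greedyBinary (β - 1) (2 * M + 2 * N)
  have hr := greedyRem_mem_Icc (s := β - 1) (by linarith [hβ.1]) (by linarith [hβ.2])
    (2 * M + 2 * N)
  have hK : (0 : ℝ) < 2 ^ (2 * M + 2 * N) := by positivity
  refine ⟨by positivity, ?_, ?_, ?_⟩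
  · push_cast
    rw [div_le_iff₀ hK]
    linarith
  · push_cast
    rw [sub_le_iff_le_add, ← add_div, le_div_iff₀ hK]
    linarith
  -- Of the `2 * M + 2 * N` digits, `2 * M` give the factor `4 ^ M` and the rest give `2 ^ (2 * N) >
  -- 2 * N`.
  · rw [pow_add, pow_mul]
    exact Nat.mul_le_mul le_rfl Nat.lt_two_pow_self.le

namespace IsApprox

variable {β : ℝ} {b K N M : ℕ}

theorem pow_mul_le (h : IsApprox β b K N M) (hN : 0 < N) {m : ℕ} (hm : m ≤ M) :
    4 ^ m * (1 / (K : ℝ)) ≤ 1 / (2 * N) := by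
  have hK : (0 : ℝ) < K := by exact_mod_cast h.pos
  have hN' : (0 : ℝ) < N := by exact_mod_cast hN
  have h1 : (4 : ℝ) ^ M * (2 * N) ≤ K := by exact_mod_cast h.large
  have h2 : (4 : ℝ) ^ m ≤ 4 ^ M := pow_le_pow_right₀ (by norm_num) hm
  rw [mul_one_div, div_le_div_iff₀ hK (by positivity), one_mul]
  exact (mul_le_mul_of_nonneg_right h2 (by positivity)).trans h1

theorem evalWord_sub (h : IsApprox β b K N M) (hβ : β ≤ 2) (hN : 0 < N) {w : List Bool}
    (hw : w.length ≤ M) :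
    0 ≤ evalWord β w - evalWord ((b : ℝ) / K) w ∧
      evalWord β w - evalWord ((b : ℝ) / K) w ≤ 1 / (2 * N) := by
  have := evalWord_sub_mem_Icc (by positivity) h.le hβ h.sub_le w
  exact ⟨this.1, this.2.trans (h.pow_mul_le hN hw)⟩

theorem pow_sub (h : IsApprox β b K N M) (hβ : β ≤ 2) (hN : 0 < N) {m : ℕ} (hm : m ≤ M) :
    0 ≤ β ^ m - ((b : ℝ) / K) ^ m ∧ β ^ m - ((b : ℝ) / K) ^ m ≤ 1 / (2 * N) := by
  have := pow_sub_mem_Icc (by positivity) h.le hβ h.sub_le m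
  exact ⟨this.1, this.2.trans (h.pow_mul_le hN hm)⟩

theorem one_div_le (hN : 0 < N) : 1 / (2 * (N : ℝ)) ≤ 1 / 2 := by
  have : (1 : ℝ) ≤ N := by exact_mod_cast hN
  exact one_div_le_one_div_of_le (by norm_num) (by linarith)

theorem close_of_eq (h : IsApprox β b K N M) (hβ : β ≤ 2) (hN : 0 < N) {v w : List Bool}
    (hl : v.length = w.length) (hw : w.length ≤ M) (he : evalWord β v = evalWord β w) :
    Close N b K v w := by
  have h1 := h.evalWord_sub hβ hN hw
  have h2 := h.evalWord_sub hβ hN (hl.trans_le hw)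
  have hN' : (0 : ℝ) < N := by exact_mod_cast hN
  rw [close_iff N b h.pos hl]
  have : |evalWord ((b : ℝ) / K) v - evalWord ((b : ℝ) / K) w| ≤ 1 / (2 * N) := by
    rw [abs_le]; constructor <;> linarith
  calc _ ≤ (N : ℝ) * (1 / (2 * N)) := by gcongr
    _ ≤ 1 := by field_simp; norm_num

/-- The tolerance `1 / N` and the approximation error `1 / (2 * N)` add up to `3 / (2 * N)`, which
is less than the separation `δ`. -/
theorem eq_of_close (h : IsApprox β b K N M) (hβ : β ≤ 2) (hN : 0 < N) {δ : ℝ}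
    (hδ : ∀ v w : List Bool, v.length = w.length → evalWord β v ≠ evalWord β w →
      δ ≤ |evalWord β v - evalWord β w|) (hNδ : 2 < N * δ) {v w : List Bool}
    (hl : v.length = w.length) (hw : w.length ≤ M) (hc : Close N b K v w) :
    evalWord β v = evalWord β w := by
  have h1 := h.evalWord_sub hβ hN hw
  have h2 := h.evalWord_sub hβ hN (hl.trans_le hw)
  have hN' : (0 : ℝ) < N := by exact_mod_cast hN
  rw [close_iff N b h.pos hl, ← le_div_iff₀' hN', abs_le] at hc
  by_contra hne
  have h3 := hδ v w hl hne
  have h4 : |evalWord β v - evalWord β w| ≤ 1 / N + 1 / (2 * N) := by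
    rw [abs_le]; constructor <;> linarith
  have h5 : N * δ ≤ N * (1 / N + 1 / (2 * N)) :=
    mul_le_mul_of_nonneg_left (h3.trans h4) hN'.le
  have h6 : (N : ℝ) * (1 / N + 1 / (2 * N)) = 3 / 2 := by field_simp; norm_num
  linarith

/-- Passing from `b / K` to `β` moves the power and the value by at most `1 / 2` each. This raises
`D` to `D + 1`, and the upper bound on the scale stays within a factor `4`. -/
theorem near_bounds (h : IsApprox β b K N M) (hβ : β ∈ Set.Ioo (1 : ℝ) 2) (hN : 0 < N) {D : ℕ}
    {u w : List Bool} (hw : w.length ≤ M) (hn : Near D b K u w) :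
    2 ^ u.length ≤ 2 * β ^ w.length ∧ β ^ w.length ≤ 4 * 2 ^ u.length ∧
      |β ^ w.length * evalWord 2 u - evalWord β w * 2 ^ u.length| ≤ (D + 1) * 2 ^ u.length := by
  obtain ⟨⟨h1, h2⟩, h3⟩ := (near_iff D b h.pos u w).1 hn
  have p := h.pow_sub hβ.2.le hN hw
  have q := h.evalWord_sub hβ.2.le hN hw
  have r := one_div_le hN
  have hm : 1 ≤ β ^ w.length := one_le_pow₀ hβ.1.le
  obtain ⟨U0, U1⟩ := evalWord_mem_Icc (t := 2) (by norm_num) le_rfl u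
  refine ⟨by linarith, by linarith, ?_⟩
  have hu : (0 : ℝ) < 2 ^ u.length := by positivity
  have a1 := mul_nonneg p.1 U0
  have a2 := mul_nonneg q.1 hu.le
  have a3 := mul_le_mul (p.2.trans r) (show evalWord (2 : ℝ) u ≤ 2 ^ u.length by linarith) U0
    (by norm_num)
  have a4 := mul_le_mul_of_nonneg_right (q.2.trans r) hu.le
  rw [abs_le] at h3 ⊢
  constructor <;> linarith

/-- The same errors in the other direction: they use up the extra `2 ^ u.length` in `h3`, and for
the scales the slack between `h1` and the factor `2` in `Near`, since `β ^ w.length ≥ 1`. -/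
theorem near_of_bounds (h : IsApprox β b K N M) (hβ : β ∈ Set.Ioo (1 : ℝ) 2) (hN : 0 < N)
    {D : ℕ} {u w : List Bool} (hw : w.length ≤ M) (h1 : 2 ^ u.length ≤ β ^ w.length)
    (h2 : β ^ w.length ≤ 2 * 2 ^ u.length)
    (h3 : |β ^ w.length * evalWord 2 u - evalWord β w * 2 ^ u.length| + 2 ^ u.length ≤
      D * 2 ^ u.length) : Near D b K u w := by
  rw [near_iff D b h.pos u w]
  have p := h.pow_sub hβ.2.le hN hw
  have q := h.evalWord_sub hβ.2.le hN hw
  have r := one_div_le hN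
  have hm : 1 ≤ β ^ w.length := one_le_pow₀ hβ.1.le
  obtain ⟨U0, U1⟩ := evalWord_mem_Icc (t := 2) (by norm_num) le_rfl u
  refine ⟨⟨by linarith, by linarith⟩, ?_⟩
  have hu : (0 : ℝ) < 2 ^ u.length := by positivity
  have a1 := mul_nonneg p.1 U0
  have a2 := mul_nonneg q.1 hu.le
  have a3 := mul_le_mul (p.2.trans r) (show evalWord (2 : ℝ) u ≤ 2 ^ u.length by linarith) U0
    (by norm_num)
  have a4 := mul_le_mul_of_nonneg_right (q.2.trans r) hu.le
  obtain ⟨h4, h5⟩ := abs_le.1 (le_sub_iff_add_le.2 h3)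
  rw [abs_le]
  constructor <;> linarith

/-- Top words of the same length and value coincide. -/
theorem eq_of_isTop (h : IsApprox β b K N M) (hβ : β ≤ 2) (hN : 0 < N) {v w : List Bool}
    (hl : v.length = w.length) (hw : w.length ≤ M) (he : evalWord β v = evalWord β w)
    (hv : IsTop N b K v) (hw' : IsTop N b K w) : v = w := by
  classical
  -- A word close to a top word `w` occurs in the decreasing list headed by `w`. Words of equal
  -- value are close to each other, so each bounds the other and no separation is needed.
  have key : ∀ {v w : List Bool}, v.length = w.length → Close N b K v w → IsTop N b K w →
      v ≤ w := by
    intro v w hl hc ht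
    obtain ⟨t, ht⟩ := List.head?_eq_some_iff.1 ht
    have hp := (pairwise_words w.length).filter fun v => decide (Close N b K v w)
    have hm : v ∈ (words w.length).filter fun v => Close N b K v w :=
      List.mem_filter.2 ⟨mem_words.2 hl, by simpa using hc⟩
    rw [ht] at hp hm
    rcases List.mem_cons.1 hm with rfl | hm
    · exact le_rfl
    · exact (List.rel_of_pairwise_cons hp hm).le
  exact le_antisymm (key hl (h.close_of_eq hβ hN hl hw he) hw')
    (key hl.symm (h.close_of_eq hβ hN hl.symm (hl.trans_le hw) he.symm) hv)

/-- By separation, the words close to the representative all have exactly its value. The head of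
their decreasing list therefore lies in the class, so it cannot exceed the representative, which is
itself in the list. -/
theorem isTop_lexMaxRep (h : IsApprox β b K N M) (hβ : β ∈ Set.Ioo (1 : ℝ) 2) (hN : 0 < N)
    {δ : ℝ} (hδ : ∀ v w : List Bool, v.length = w.length → evalWord β v ≠ evalWord β w →
      δ ≤ |evalWord β v - evalWord β w|) (hNδ : 2 < N * δ) {w : List Bool} (hw : w.length ≤ M) :
    IsTop N b K (lexMaxRep β w) := by
  classical
  obtain ⟨⟨hl, hv⟩, hmax⟩ := lexMaxRep_isGreatest β w
  set v := lexMaxRep β w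
  have hβ0 : β ≠ 0 := by linarith [hβ.1]
  have hmem : v ∈ (words v.length).filter fun z => Close N b K z v :=
    List.mem_filter.2 ⟨mem_words.2 rfl,
      by simpa using h.close_of_eq hβ.2.le hN rfl (hl.trans_le hw) rfl⟩
  have hp := (pairwise_words v.length).filter fun z => decide (Close N b K z v)
  rw [IsTop]
  rcases hL : (words v.length).filter fun z => Close N b K z v with _ | ⟨z, t⟩
  · rw [hL] at hmem
    simp at hmem
  · have hz : z ∈ (words v.length).filter fun z => Close N b K z v := by simp [hL]
    obtain ⟨hz1, hz2⟩ := List.mem_filter.1 hz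
    have hz1 := mem_words.1 hz1
    have he := h.eq_of_close hβ.2.le hN hδ hNδ hz1 (hl.trans_le hw) (by simpa using hz2)
    rw [evalWord_eq hβ0, evalWord_eq hβ0, hz1] at he
    have he := mul_left_cancel₀ (pow_ne_zero _ hβ0) he
    have hzv : z ≤ v := hmax ⟨hz1.trans hl, he.trans hv⟩
    rw [hL] at hp hmem
    rcases List.mem_cons.1 hmem with rfl | hm
    · rfl
    · exact absurd (List.rel_of_pairwise_cons hp hm) (not_lt.2 hzv)

end IsApprox

/-! ### Bounded lists of candidates -/

/-- Nearness fixes the length up to `2` and, at each length, confines the integer binary value to an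
interval of bounded size. -/
theorem length_nearLeft_le {β : ℝ} (hβ : β ∈ Set.Ioo (1 : ℝ) 2) {b N D : ℕ} (hN : 0 < N)
    {u w : List Bool} (h : IsApprox β b (2 ^ (2 * w.length + 2 * N)) N w.length)
    (h1 : 2 ^ u.length ≤ β ^ w.length) (h2 : β ^ w.length ≤ 2 * 2 ^ u.length) :
    (nearLeft D (2 * N) w b).length ≤
      (2 * 2 + 1) * (⌊2 * (4 * ((D : ℝ) + 1)) / 1⌋₊ + 1) := by
  classical
  have hmem : ∀ v ∈ nearLeft D (2 * N) w b, _ := fun v hv =>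
    h.near_bounds hβ hN le_rfl (of_decide_eq_true (List.mem_filter.1 hv).2)
  have h4 : (2 : ℝ) ^ 2 = 4 := by norm_num
  have hm : 0 < β ^ w.length := pow_pos (by linarith [hβ.1]) _
  refine length_le_of_separated (ℓ := List.length) (g := evalWord 2)
    (t := fun n => evalWord β w * 2 ^ n / β ^ w.length) (c := u.length)
    ((nodup_wordsUpTo _).filter _) one_pos (fun v hv => ?_) (fun v hv => ?_)
    fun v _ v' _ hne hl => one_le_abs_evalWord_two_sub hl hne
  · obtain ⟨b1, b2, -⟩ := hmem v hv
    constructor <;> refine (pow_le_pow_iff_right₀ (by norm_num : (1 : ℝ) < 2)).1 ?_ <;>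
      rw [pow_add, h4] <;> linarith
  · obtain ⟨b1, -, b3⟩ := hmem v hv
    have e : evalWord 2 v - evalWord β w * 2 ^ v.length / β ^ w.length =
        (β ^ w.length * evalWord 2 v - evalWord β w * 2 ^ v.length) / β ^ w.length := by
      field_simp
    rw [e, abs_div, abs_of_pos hm, div_le_iff₀ hm]
    have hD : (0 : ℝ) ≤ D := Nat.cast_nonneg D
    nlinarith [mul_le_mul_of_nonneg_left b1 (show (0 : ℝ) ≤ D + 1 by linarith),
      mul_nonneg hD hm.le]

/-- Scales agree up to a factor `4 < β ^ J`, which fixes the length up to `J`. Distinct top words of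
one length have distinct values, hence values `δ` apart; without the top condition, many words could
share a value. -/
theorem length_nearRight_le {β : ℝ} (hβ : β ∈ Set.Ioo (1 : ℝ) 2) {b N D L J : ℕ} (hN : 0 < N)
    (hJ : 4 < β ^ J) {δ : ℝ} (hδ0 : 0 < δ)
    (hδ : ∀ v w : List Bool, v.length = w.length → evalWord β v ≠ evalWord β w →
      δ ≤ |evalWord β v - evalWord β w|) {u w : List Bool}
    (h : IsApprox β b (2 ^ (2 * (L * u.length + 1) + 2 * N)) N (L * u.length + 1))
    (h1 : 2 ^ u.length ≤ β ^ w.length) (h2 : β ^ w.length ≤ 2 * 2 ^ u.length) :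
    (nearRight D (2 * N) L N u b).length ≤
      (2 * J + 1) * (⌊2 * ((D : ℝ) + 1) / δ⌋₊ + 1) := by
  classical
  have hlen : ∀ v ∈ nearRight D (2 * N) L N u b, v.length ≤ L * u.length + 1 := fun v hv =>
    mem_wordsUpTo.1 (List.mem_filter.1 hv).1
  have hmem : ∀ v ∈ nearRight D (2 * N) L N u b, _ := fun v hv =>
    h.near_bounds hβ hN (hlen v hv) (of_decide_eq_true (List.mem_filter.1 hv).2).1
  have htop : ∀ v ∈ nearRight D (2 * N) L N u b, _ := fun v hv =>
    (of_decide_eq_true (List.mem_filter.1 hv).2).2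
  have hβ0 : 0 < β := by linarith [hβ.1]
  have hu : (0 : ℝ) < 2 ^ u.length := by positivity
  refine length_le_of_separated (ℓ := List.length) (g := evalWord β)
    (t := fun m => β ^ m * evalWord 2 u / 2 ^ u.length) (c := w.length)
    ((nodup_wordsUpTo _).filter _) hδ0 (fun v hv => ?_) (fun v hv => ?_)
    fun v hv v' hv' hne hl => hδ v v' hl fun he => hne
      (h.eq_of_isTop hβ.2.le hN hl (hlen v' hv') he (htop v hv) (htop v' hv'))
  · obtain ⟨b1, b2, -⟩ := hmem v hv
    have hw : 0 < β ^ w.length := by positivity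
    have hv' : 0 < β ^ v.length := by positivity
    constructor <;> refine ((pow_lt_pow_iff_right₀ hβ.1).1 ?_).le <;> rw [pow_add] <;> nlinarith
  · obtain ⟨-, -, b3⟩ := hmem v hv
    have e : evalWord β v - β ^ v.length * evalWord 2 u / 2 ^ u.length =
        -((β ^ v.length * evalWord 2 u - evalWord β v * 2 ^ u.length) / 2 ^ u.length) := by
      field_simp
      ring
    rw [e, abs_neg, abs_div, abs_of_pos hu, div_le_iff₀ hu]
    exact b3

/-! ### Bounded difference of the complexities, and the limit. -/

/-- The complexities of the two expansions differ by a bounded amount. -/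
theorem exists_abs_complexity_sub_le (U : List Bool → (ℕ → Bool) → Part (List Bool))
    (hU : IsUniversal U) {β : ℝ} (hβ : β ∈ Set.Ioo (1 : ℝ) 2) (hP : IsPisot β) {x : ℕ → Bool}
    (hx : x ∈ Omega β) :
    ∃ c : ℕ, ∀ n, |(complexityRel U (lexMaxPre β x (scaledLength β n)) β : ℝ) -
      complexityRel U (pre (greedyBinary (seqValue β x)) n) β| ≤ c := by
  classical
  obtain ⟨δ, hδ0, hδ⟩ := hP.exists_separation
  obtain ⟨N, hN⟩ := exists_nat_gt (2 / δ)
  have hNδ : 2 < N * δ := (div_lt_iff₀ hδ0).1 hN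
  have hN0 : 0 < N := by
    rcases Nat.eq_zero_or_pos N with rfl | h
    · norm_num at hNδ
    · exact h
  obtain ⟨J, hJ⟩ := pow_unbounded_of_one_lt 4 hβ.1
  -- In units of `2 ^ n`: the tail of the `β`-expansion contributes at most `(β - 1)⁻¹`, the binary
  -- remainder times `β ^ m` at most `2`, and `near_of_bounds` requires `1` more.
  obtain ⟨D, hD⟩ := exists_nat_ge ((β - 1)⁻¹ + 3)
  set L := ⌈Real.logb β 2⌉₊
  have hκl : Primrec fun w : List Bool => 2 * w.length + 2 * N :=
    Primrec.nat_add.comp (Primrec.nat_mul.comp (Primrec.const 2) Primrec.list_length)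
      (Primrec.const _)
  have hκr : Primrec fun u : List Bool => 2 * (L * u.length + 1) + 2 * N :=
    Primrec.nat_add.comp (Primrec.nat_mul.comp (Primrec.const 2)
      (Primrec.succ.comp (Primrec.nat_mul.comp (Primrec.const L) Primrec.list_length)))
      (Primrec.const _)
  obtain ⟨c₁, hc₁⟩ := exists_complexity_le_add_of_mem_list hU (primrec_nearLeft D (2 * N)) hκl
    ((2 * 2 + 1) * (⌊2 * (4 * ((D : ℝ) + 1)) / 1⌋₊ + 1))
  obtain ⟨c₂, hc₂⟩ := exists_complexity_le_add_of_mem_list hU (primrec_nearRight D (2 * N) L N) hκr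
    ((2 * J + 1) * (⌊2 * ((D : ℝ) + 1) / δ⌋₊ + 1))
  refine ⟨c₁ + c₂, fun n => ?_⟩
  set s := seqValue β x with hs
  set m := scaledLength β n with hm
  set u := pre (greedyBinary s) n with hu
  set w := lexMaxPre β x m with hw
  obtain ⟨hm1, hm2, hnm, hmL⟩ := scaledLength_bounds hβ n
  have hul : u.length = n := length_pre _ _
  have hwl : w.length = m := by
    rw [hw, lexMaxPre, (lexMaxRep_isGreatest β (pre x m)).1.1, length_pre]
  have hβ0 : β ≠ 0 := by linarith [hβ.1]
  have hwe : evalWord β w = evalWord β (pre x m) := by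
    rw [evalWord_eq hβ0, evalWord_eq hβ0, hwl, length_pre, hw, wordValue_lexMaxPre]
  have h1 : (2 : ℝ) ^ u.length ≤ β ^ w.length := by rw [hul, hwl]; exact hm1
  have h2 : β ^ w.length ≤ 2 * 2 ^ u.length := by rw [hul, hwl]; exact hm2
  have h3 : |β ^ w.length * evalWord 2 u - evalWord β w * 2 ^ u.length| + 2 ^ u.length ≤
      D * 2 ^ u.length := by
    have e1 := evalWord_pre_greedyBinary s n
    have e2 := greedyRem_mem_Icc (seqValue_nonneg hβ.1 x) hx n
    have e3 := seqValue_sub_mem_Icc hβ.1 x m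
    rw [← hs] at e2 e3
    rw [← hu] at e1
    rw [hwe, hul, hwl]
    have hp : (0 : ℝ) < 2 ^ n := by positivity
    have hq : 0 < β ^ m := hp.trans_le hm1
    -- Both words are compared with `s`: the common term `s * β ^ m * 2 ^ n` cancels, leaving the
    -- two truncation errors.
    have e4 : β ^ m * evalWord 2 u - evalWord β (pre x m) * 2 ^ n =
        (s * β ^ m - evalWord β (pre x m)) * 2 ^ n - β ^ m * greedyRem s n := by
      linear_combination (-β ^ m) * e1
    have a1 := mul_nonneg e3.1 hp.le
    have a2 := mul_le_mul_of_nonneg_right e3.2 hp.le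
    have a3 := mul_nonneg hq.le e2.1
    have a4 := mul_le_mul_of_nonneg_left e2.2 hq.le
    have a5 := mul_le_mul_of_nonneg_right hD hp.le
    have a6 := mul_nonneg (inv_nonneg.2 (show 0 ≤ β - 1 by linarith [hβ.1])) hp.le
    rw [e4, ← le_sub_iff_add_le, abs_le]
    constructor <;> linarith
  have hl := isApprox_oracleFloor hβ w.length N
  have hr := isApprox_oracleFloor hβ (L * u.length + 1) N
  have hwL : w.length ≤ L * u.length + 1 := by rw [hwl, hul]; exact hmL
  have k1 := hc₁ w u (greedyBinary (β - 1))
    (List.mem_filter.2 ⟨mem_wordsUpTo.2 (by rw [hwl, hul]; exact hnm),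
      decide_eq_true (hl.near_of_bounds hβ hN0 le_rfl h1 h2 h3)⟩)
    (length_nearLeft_le hβ hN0 hl h1 h2)
  have k2 := hc₂ u w (greedyBinary (β - 1))
    (List.mem_filter.2 ⟨mem_wordsUpTo.2 hwL,
      decide_eq_true ⟨hr.near_of_bounds hβ hN0 hwL h1 h2 h3,
        hr.isTop_lexMaxRep hβ hN0 hδ hNδ (by rw [length_pre, ← hwl]; exact hwL)⟩⟩)
    (length_nearRight_le hβ hN0 hJ hδ0 hδ hr h1 h2)
  have k1' : (complexityRel U u β : ℝ) ≤ complexityRel U w β + c₁ := by exact_mod_cast k1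
  have k2' : (complexityRel U w β : ℝ) ≤ complexityRel U u β + c₂ := by exact_mod_cast k2
  push_cast
  rw [abs_le]
  constructor <;> linarith [Nat.cast_nonneg (α := ℝ) c₁, Nat.cast_nonneg (α := ℝ) c₂]

theorem tendsto_gap (U : List Bool → (ℕ → Bool) → Part (List Bool))
    (hU : IsUniversal U) {β : ℝ} (hβ : β ∈ Set.Ioo (1 : ℝ) 2) (hP : IsPisot β) {x : ℕ → Bool}
    (hx : x ∈ Omega β) :
    Tendsto (fun n => gap U β (seqValue β x) (lexMaxPre β x) n) atTop (nhds 0) := by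
  obtain ⟨c, hc⟩ := exists_abs_complexity_sub_le U hU hβ hP hx
  refine squeeze_zero_norm (fun n => ?_) (tendsto_const_div_atTop_nhds_zero_nat (c : ℝ))
  rw [gap, norm_div, Real.norm_eq_abs, Real.norm_natCast]
  exact div_le_div_of_nonneg_right (hc n) (Nat.cast_nonneg n)

end BetaComplexity

end

theorem mainTheorem6 (U : List Bool → (ℕ → Bool) → Part (List Bool))
    (hU : BetaComplexity.IsUniversal U) (β : ℝ) (hβ : β ∈ Set.Ioo (1 : ℝ) 2)
    (hP : BetaComplexity.IsPisot β) (x : ℕ → Bool) (hx : x ∈ BetaComplexity.Omega β) :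
    BetaComplexity.lowerDelta U β (BetaComplexity.seqValue β x)
        (BetaComplexity.lexMaxPre β x) = 0 ∧
      BetaComplexity.upperDelta U β (BetaComplexity.seqValue β x)
        (BetaComplexity.lexMaxPre β x) = 0 := by
  have h := (continuous_coe_real_ereal.tendsto 0).comp
    (BetaComplexity.tendsto_gap U hU hβ hP hx)
  exact ⟨h.liminf_eq, h.limsup_eq⟩
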